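/- Let $\mathbb{D}$ be the open unit disc, $H(\mathbb{D})$ the space of holomorphic functions on $\mathbb{D}$, and $dA = \frac{1}{\pi}\,dx\,dy$. For a positive Borel measure $\nu$ on $\mathbb{D}$, call $\nu$ a Hankel measure if there is a constant $C>0$ such that, for every $f$ in the Hardy space $H^2$, the integral $\int_{\mathbb{D}} f^2\,d\nu$ exists (absolutely) and $\left|\int_{\mathbb{D}} f(z)^2\,d\nu(z)\right|\le C\|f\|_{H^2}^2$, where $\|f\|_{H^2}^2=\sup_{0<r<1}\frac1{2\pi}\int_0^{2\pi}|f(re^{i\theta})|^2\,d\theta$. For $0<p<\infty$, let $\mathcal{Q}_p$ be the space of $f\in H(\mathbb{D})$ with $$\sup_{a\in\mathbb{D}}\int_{\mathbb{D}}|f'(z)|^2\left(1-|\sigma_a(z)|^2\right)^p dA(z)<\infty,\qquad \sigma_a(z)=\frac{a-z}{1-\overline{a}z}.$$ Let $\mu$ be a positive Borel measure on $[0,1)$, regarded also as a measure on $\mathbb{D}$ by $E\mapsto\mu(E\cap[0,1))$. Put $P_\mu(w)=\int_0^1\frac{d\mu(t)}{1-wt}$ for $w\in\mathbb{D}$ and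 $\mu[n]=\int_0^1 t^n\,d\mu(t)$ for $n\ge 0$. Then the following conditions are equivalent, where each condition includes the requirement that the integrals in it exist as finite (absolutely convergent) integrals, for all $w\in\mathbb{D}$ in (2)--(4) and for all $n\ge0$ in (5) (this is automatic in (2)--(5) if $\mu$ is finite): 1. $\mu$ is a Hankel measure. 2. $\displaystyle\sup_{w\in\mathbb{D}}\left|\int_0^1\frac{1-|w|^2}{(1-\overline{w}t)^2}\,d\mu(t)\right|<\infty$. 3. $P_\mu\in\mathcal{Q}_p$ for some $0<p<\infty$. 4. $P_\mu\in\mathcal{Q}_p$ for all $0<p<\infty$. 5. $\mu[n]=O(1/n)$ as $n\to\infty$. -/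

import Mathlib

open MeasureTheory Asymptotics Filter
open scoped ENNReal ComplexConjugate

noncomputable section

/-- The open unit disc of the complex plane. -/
abbrev Disc : Set ℂ := Metric.ball (0 : ℂ) 1

/-- The integral mean of `|f|^p` over the circle of radius `r` about the origin,
`(1/2π) ∫₀^{2π} |f(r e^{iθ})|^p dθ`. -/
def hardyMean (p : ℝ) (f : ℂ → ℂ) (r : ℝ) : ℝ :=
  (2 * Real.pi)⁻¹ *
    ∫ θ in (0 : ℝ)..(2 * Real.pi), ‖f (r * Complex.exp (θ * Complex.I))‖ ^ p

/-- Membership in the Hardy space `H^p` of the unit disc: `f` is holomorphic in the disc and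
its integral means over the circles of radius `0 < r < 1` are bounded. -/
def MemHardy (p : ℝ) (f : ℂ → ℂ) : Prop :=
  DifferentiableOn ℂ f Disc ∧ BddAbove (hardyMean p f '' Set.Ioo (0 : ℝ) 1)

/-- The Hardy space norm, meaningful for members of `H^p`. -/
def hardyNorm (p : ℝ) (f : ℂ → ℂ) : ℝ :=
  (sSup (hardyMean p f '' Set.Ioo (0 : ℝ) 1)) ^ (1 / p)

/-- A positive Borel measure `ν` on the disc is a Hankel measure if there is `C > 0` such that
`|∫ f² dν| ≤ C ‖f‖²` for all `f` in `H²`; the existence of the integrals is included. -/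
def IsHankelMeasure (ν : Measure Disc) : Prop :=
  ∃ C : ℝ, 0 < C ∧ ∀ f : ℂ → ℂ, MemHardy 2 f →
    Integrable (fun z : Disc => f z ^ 2) ν ∧
      ‖∫ z : Disc, f z ^ 2 ∂ν‖ ≤ C * hardyNorm 2 f ^ 2

/-- The integral `∫ dν(z) / (1 - w z̄)` exists for every `w` in the disc. -/
def CauchyTransformExists (ν : Measure Disc) : Prop :=
  ∀ w ∈ Disc, Integrable (fun z : Disc => 1 / (1 - w * conj (z : ℂ))) ν

/-- The function `P_ν(w) = ∫ dν(z) / (1 - w z̄)`. -/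
def cauchyTransform (ν : Measure Disc) (w : ℂ) : ℂ :=
  ∫ z : Disc, 1 / (1 - w * conj (z : ℂ)) ∂ν

/-- The Möbius map `σ_a(z) = (a - z) / (1 - ā z)` interchanging `a` and `0`. -/
def mobius (a z : ℂ) : ℂ := (a - z) / (1 - conj a * z)

/-- The normalized area measure `dA = dx dy / π` on the unit disc. -/
def areaMeasure : Measure ℂ := (ENNReal.ofReal Real.pi)⁻¹ • volume.restrict Disc

/-- Membership in `Q_p`: `f` is holomorphic in the disc and
`sup_{a} ∫ |f'(z)|² (1 - |σ_a(z)|²)^p dA(z) < ∞`, the supremum being over the disc. -/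
def MemQ (p : ℝ) (f : ℂ → ℂ) : Prop :=
  DifferentiableOn ℂ f Disc ∧
    (⨆ a ∈ Disc, ∫⁻ z, ENNReal.ofReal (‖deriv f z‖ ^ 2 * (1 - ‖mobius a z‖ ^ 2) ^ p)
      ∂areaMeasure) < ∞

/-- The inclusion of `[0, 1)` in the unit disc. -/
def icoToDisc (t : Set.Ico (0 : ℝ) 1) : Disc :=
  ⟨((t : ℝ) : ℂ), by
    rw [mem_ball_zero_iff, Complex.norm_real, Real.norm_eq_abs, abs_of_nonneg t.2.1]
    exact t.2.2⟩

theorem measurable_icoToDisc : Measurable icoToDisc :=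
  (Complex.measurable_ofReal.comp measurable_subtype_coe).subtype_mk

/-- A measure on `[0, 1)` seen as a measure on the disc. -/
def toDisc (μ : Measure (Set.Ico (0 : ℝ) 1)) : Measure Disc := μ.map icoToDisc

/-- `toDisc μ` assigns to a Borel set `E` the value `μ (E ∩ [0, 1))`. -/
theorem toDisc_apply (μ : Measure (Set.Ico (0 : ℝ) 1)) {E : Set Disc} (hE : MeasurableSet E) :
    toDisc μ E = μ {t | icoToDisc t ∈ E} :=
  Measure.map_apply measurable_icoToDisc hE

/-- The moment `μ[n] = ∫ tⁿ dμ(t)`. -/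
def moment (μ : Measure (Set.Ico (0 : ℝ) 1)) (n : ℕ) : ℝ :=
  ∫ t : Set.Ico (0 : ℝ) 1, (t : ℝ) ^ n ∂μ

end

/-!
All five conditions are statements about the concentration of `μ` near `1`, and the moment
condition `μ[n] = O(1/n)` is the hub: each of the others is compared with it. Every condition
forces `μ` to be finite, by evaluation at `w = 0`, at `n = 0` or at a constant function.

*Lower bounds for the moments.* At `r = n / (n + 1)` one has `(n + 1)² tⁿ / 2 ≤ 1 / (1 - r t)²` on
`[0, 1]` (`pow_le_kernel`). The Hankel condition, applied to the square root of the kernel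
`(1 - |w|²) / (1 - w̄ z)²`, whose `H²` norm is at most one by Parseval's identity, bounds the kernel
integrals, and these bound the moments at `w = r`. If `P_μ` belongs to some `Q_p`, the seminorm is
tested at `a = r`: on a disc about `r` of radius comparable to `1 - r` the kernels
`1 / (1 - z t)²` have positive real part, so `|P_μ'|` is at least `(n + 1)² μ[n + 1] / 10`
(`moment_le_norm_deriv`) while the conformal weight is at least `2⁻ᵖ`.

*Upper bounds from the moments.* For `f = ∑ aₙ zⁿ` in `H²`, `∫ |f|² dμ` is at most
`∑∑ |aₙ| |aₘ| μ[n + m]`, and Schur's test for the Hilbert matrix bounds this by a multiple of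
`∑ |aₙ|²` (`lintegral_sq_le`). For `Q_p`, the moment condition gives
`∫ (1 - t + δ)⁻² dμ(t) ≤ C / δ`, and `|1 - z t|` is comparable to `1 - t + |1 - z|`, so
`|P_μ'(z)| ≤ 9 C / |1 - z|` (`norm_deriv_le`): it suffices to treat the logarithm. With
`ρ = |1 - z|` and `d = |1 - a|`, the weight `1 - |σ_a(z)|²` is at most `16 min (ρ / d) (d / ρ)`
(`one_sub_mobius_sq_le`). In polar coordinates about `1` the integral is then at most a multiple of
`∫ min (ρ / d) (d / ρ) ^ p dρ / ρ`, which is finite and, by scaling, independent of `d`.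
-/

/-! ### Moments and the decay `O(1/n)` -/

theorem pow_mul_one_add_sq_le_two (n : ℕ) {t : ℝ} (h0 : 0 ≤ t) (h1 : t ≤ 1) :
    t ^ n * (1 + n * (1 - t)) ^ 2 ≤ 2 := by
  set y : ℝ := n * (1 - t) with hy
  have hy0 : 0 ≤ y := mul_nonneg n.cast_nonneg (by linarith)
  have hexp : t ^ n ≤ Real.exp (-y) := by
    have h : t ≤ Real.exp (-(1 - t)) := by
      have := Real.add_one_le_exp (-(1 - t)); linarith
    calc t ^ n ≤ Real.exp (-(1 - t)) ^ n := by gcongr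
      _ = Real.exp (-y) := by rw [← Real.exp_nat_mul, hy]; ring_nf
  have hq := Real.quadratic_le_exp_of_nonneg hy0
  calc t ^ n * (1 + y) ^ 2 ≤ Real.exp (-y) * (2 * Real.exp y) := by
        gcongr; nlinarith
    _ = 2 := by rw [mul_left_comm, ← Real.exp_add]; simp

theorem integrable_pow (μ : Measure (Set.Ico (0 : ℝ) 1)) [IsFiniteMeasure μ] (n : ℕ) :
    Integrable (fun t : Set.Ico (0 : ℝ) 1 => (t : ℝ) ^ n) μ := by
  refine Integrable.of_bound (C := 1)
    (measurable_subtype_coe.pow_const n).aestronglyMeasurable (ae_of_all _ fun t => ?_)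
  rw [Real.norm_of_nonneg (pow_nonneg t.2.1 _)]
  exact pow_le_one₀ t.2.1 t.2.2.le

/-- The point `n / (n + 1)` of the disc serves as the test point for the `n`-th moment. -/
theorem testRadius_mem (n : ℕ) : ((n / (n + 1) : ℝ) : ℂ) ∈ Disc := by
  have : (0 : ℝ) < n + 1 := by positivity
  rw [mem_ball_zero_iff, Complex.norm_real, Real.norm_of_nonneg (by positivity), div_lt_one this]
  linarith

theorem one_sub_testRadius_mul (n : ℕ) (t : ℝ) :
    1 - n / (n + 1) * t = (1 + n * (1 - t)) / (n + 1) := by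
  have : (0 : ℝ) < n + 1 := by positivity
  field_simp; ring

/-- The kernel `1 / (1 - r t)²` at `r = n / (n + 1)` dominates `(n + 1)² tⁿ`. -/
theorem pow_le_kernel (n : ℕ) {t : ℝ} (h0 : 0 ≤ t) (h1 : t ≤ 1) :
    (n + 1 : ℝ) ^ 2 * t ^ n / 2 ≤ 1 / (1 - n / (n + 1) * t) ^ 2 := by
  have hn : (0 : ℝ) < n + 1 := by positivity
  have hpos : (0 : ℝ) < 1 + n * (1 - t) := by
    have : 0 ≤ (n : ℝ) * (1 - t) := mul_nonneg n.cast_nonneg (by linarith)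
    linarith
  rw [one_sub_testRadius_mul, div_pow, one_div_div, div_le_div_iff₀ two_pos (by positivity)]
  have := pow_mul_one_add_sq_le_two n h0 h1
  nlinarith [sq_nonneg (n + 1 : ℝ)]

/-- A bound for the shifted moments suffices for the decay `O(1/n)`. -/
theorem moment_isBigO_of_le (μ : Measure (Set.Ico (0 : ℝ) 1)) {C : ℝ}
    (h : ∀ n : ℕ, (n + 1) * moment μ (n + 1) ≤ C) :
    moment μ =O[atTop] (fun n : ℕ => 1 / (n : ℝ)) := by
  refine IsBigO.of_bound C ?_
  filter_upwards [eventually_ge_atTop 1] with n hn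
  obtain ⟨k, rfl⟩ := Nat.exists_eq_add_of_le' hn
  have hk : (0 : ℝ) < k + 1 := by positivity
  have h0 : 0 ≤ moment μ (k + 1) := integral_nonneg fun t => pow_nonneg t.2.1 _
  rw [Real.norm_of_nonneg h0, Real.norm_of_nonneg (by positivity)]
  push_cast
  rw [mul_one_div, le_div_iff₀ hk, mul_comm]
  exact h k

/-- The moment condition in the form used for upper bounds: `∫ tⁿ dμ ≤ C / (n + 1)` for all `n`.
Stated for the integral with values in `[0, ∞]`, it includes the finiteness of the moments. -/
def MomentBound (μ : Measure (Set.Ico (0 : ℝ) 1)) (C : ℝ) : Prop :=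
  ∀ n : ℕ, ∫⁻ t : Set.Ico (0 : ℝ) 1, ENNReal.ofReal ((t : ℝ) ^ n) ∂μ ≤ ENNReal.ofReal (C / (n + 1))

theorem exists_momentBound {μ : Measure (Set.Ico (0 : ℝ) 1)}
    (hi : ∀ n : ℕ, Integrable (fun t : Set.Ico (0 : ℝ) 1 => (t : ℝ) ^ n) μ)
    (hO : moment μ =O[atTop] (fun n : ℕ => 1 / (n : ℝ))) : ∃ C, 0 < C ∧ MomentBound μ C := by
  obtain ⟨C, hC, hb⟩ := bound_of_isBigO_nat_atTop hO
  have h0 : ∀ n, 0 ≤ moment μ n := fun n => integral_nonneg fun t => pow_nonneg t.2.1 _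
  refine ⟨2 * C + moment μ 0, by linarith [h0 0], fun n => ?_⟩
  rw [← ofReal_integral_eq_lintegral_ofReal (hi n) (ae_of_all _ fun t => pow_nonneg t.2.1 _)]
  refine ENNReal.ofReal_le_ofReal ?_
  change moment μ n ≤ _
  have hn1 : (0 : ℝ) < n + 1 := by positivity
  rw [le_div_iff₀ hn1]
  rcases Nat.eq_zero_or_pos n with rfl | hn
  · simp; linarith
  · have hn' : (1 : ℝ) ≤ n := by exact_mod_cast hn
    have := hb (x := n) (by positivity)
    rw [Real.norm_of_nonneg (h0 n), Real.norm_of_nonneg (by positivity), mul_one_div,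
      le_div_iff₀ (by positivity)] at this
    nlinarith [h0 n, h0 0]

/-! ### Parseval's identity on circles -/

/-- Parseval's identity for an absolutely convergent power series on the unit circle. -/
theorem hasSum_sq_norm_of_summable {c : ℕ → ℂ} (hc : Summable fun n => ‖c n‖) {g : ℝ → ℂ}
    (hg : ∀ θ : ℝ, HasSum (fun n => c n * Complex.exp (θ * Complex.I) ^ n) (g θ)) :
    HasSum (fun n => ‖c n‖ ^ 2)
      ((2 * Real.pi)⁻¹ * ∫ θ in (0 : ℝ)..(2 * Real.pi), ‖g θ‖ ^ 2) := by
  have hnorm : ∀ θ : ℝ, ‖Complex.exp (θ * Complex.I)‖ = 1 := Complex.norm_exp_ofReal_mul_I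
  let F : ℕ × ℕ → ℝ → ℂ := fun p θ =>
    (c p.1 * Complex.exp (θ * Complex.I) ^ p.1) * conj (c p.2 * Complex.exp (θ * Complex.I) ^ p.2)
  have hFn : ∀ p θ, ‖F p θ‖ = ‖c p.1‖ * ‖c p.2‖ := fun p θ => by simp [F, hnorm]
  have hsum : Summable fun p : ℕ × ℕ => ‖c p.1‖ * ‖c p.2‖ :=
    hc.mul_of_nonneg hc (fun _ => norm_nonneg _) (fun _ => norm_nonneg _)
  have hF : ∀ θ, HasSum (fun p => F p θ) (((‖g θ‖ ^ 2 : ℝ) : ℂ)) := by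
    intro θ
    have h2 : HasSum (fun n => conj (c n * Complex.exp (θ * Complex.I) ^ n)) (conj (g θ)) :=
      (hg θ).map (starRingEnd ℂ) Complex.continuous_conj
    have h3 := (hg θ).mul h2 (Summable.of_norm (by simpa [hnorm] using hsum))
    rw [Complex.mul_conj, Complex.normSq_eq_norm_sq] at h3
    exact h3
  have hint := intervalIntegral.hasSum_integral_of_dominated_convergence (μ := volume)
    (a := 0) (b := 2 * Real.pi) (F := F) (f := fun θ => (((‖g θ‖ ^ 2 : ℝ) : ℂ)))
    (fun p _ => ‖c p.1‖ * ‖c p.2‖)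
    (fun p => (by fun_prop : Continuous (F p)).aestronglyMeasurable)
    (fun p => ae_of_all _ fun θ _ => (hFn p θ).le) (ae_of_all _ fun θ _ => hsum)
    intervalIntegrable_const (ae_of_all _ fun θ _ => hF θ)
  have hval : ∀ p : ℕ × ℕ, ∫ θ in (0 : ℝ)..(2 * Real.pi), F p θ
      = if p.1 = p.2 then ((2 * Real.pi * ‖c p.1‖ ^ 2 : ℝ) : ℂ) else 0 := by
    rintro ⟨n, m⟩
    have hFe : ∀ θ : ℝ, F (n, m) θ
        = c n * conj (c m) * Complex.exp ((((n : ℂ) - m) * Complex.I) * θ) := by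
      intro θ
      simp only [F, map_mul, ← Complex.exp_conj, ← Complex.exp_nat_mul,
        Complex.conj_ofReal, Complex.conj_I, Complex.conj_natCast]
      rw [mul_mul_mul_comm, ← Complex.exp_add]
      ring_nf
    simp only [hFe, intervalIntegral.integral_const_mul]
    split_ifs with h
    · subst h
      simp [Complex.mul_conj, Complex.normSq_eq_norm_sq]
      ring
    · have hne : ((n : ℂ) - m) * Complex.I ≠ 0 :=
        mul_ne_zero (sub_ne_zero.2 (by exact_mod_cast h)) Complex.I_ne_zero
      rw [integral_exp_mul_complex hne]
      have : Complex.exp (((n : ℂ) - m) * Complex.I * ((2 * Real.pi : ℝ) : ℂ)) = 1 := by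
        rw [Complex.exp_eq_one_iff]
        exact ⟨(n : ℤ) - m, by push_cast; ring⟩
      rw [this]; simp
  simp only [hval] at hint
  have hinj : Function.Injective fun n : ℕ => (n, n) := fun a b h => (Prod.ext_iff.1 h).1
  rw [← hinj.hasSum_iff (by
    rintro ⟨n, m⟩ hp
    exact if_neg fun h => hp ⟨n, Prod.ext rfl h⟩), intervalIntegral.integral_ofReal] at hint
  simp only [Function.comp_def, if_true] at hint
  have := (Complex.hasSum_ofReal.1 hint).mul_left (2 * Real.pi)⁻¹
  simpa [← mul_assoc, Real.pi_ne_zero] using this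

/-! ### The Hardy space `H²` in terms of Taylor coefficients -/

theorem hasSum_hardyMean {f : ℂ → ℂ} {a : ℕ → ℂ} (hf : ∀ z ∈ Disc, HasSum (fun n => a n * z ^ n) (f z))
    {r : ℝ} (hr : r ∈ Set.Ioo (0 : ℝ) 1) :
    HasSum (fun n => ‖a n‖ ^ 2 * (r ^ 2) ^ n) (hardyMean 2 f r) := by
  have hmem : ∀ θ : ℝ, (r : ℂ) * Complex.exp (θ * Complex.I) ∈ Disc := fun θ => by
    simpa [Complex.norm_exp_ofReal_mul_I, abs_of_pos hr.1] using hr.2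
  have hc : Summable fun n => ‖a n * (r : ℂ) ^ n‖ := by
    have := (hf _ (hmem 0)).summable.norm
    simpa using this
  have := hasSum_sq_norm_of_summable hc (g := fun θ => f (r * Complex.exp (θ * Complex.I)))
    (fun θ => by simpa [mul_pow, mul_assoc] using hf _ (hmem θ))
  simp only [hardyMean, Real.rpow_two]
  convert this using 2 with n
  rw [norm_mul, norm_pow, Complex.norm_real, Real.norm_of_nonneg hr.1.le, mul_pow, ← pow_mul,
    ← pow_mul, mul_comm 2]

theorem hardyMean_nonneg (p : ℝ) (f : ℂ → ℂ) (r : ℝ) : 0 ≤ hardyMean p f r :=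
  mul_nonneg (by positivity) (intervalIntegral.integral_nonneg (by positivity)
    fun _ _ => by positivity)

theorem hardyNorm_two_sq (f : ℂ → ℂ) :
    hardyNorm 2 f ^ 2 = sSup (hardyMean 2 f '' Set.Ioo (0 : ℝ) 1) := by
  rw [hardyNorm, ← Real.sqrt_eq_rpow, Real.sq_sqrt]
  refine Real.sSup_nonneg ?_
  rintro _ ⟨r, -, rfl⟩
  exact hardyMean_nonneg 2 f r

/-- The Taylor coefficients of an `H²` function are square summable, with norm at most the
Hardy norm. -/
theorem tsum_sq_coeff_le {f : ℂ → ℂ} (hf : MemHardy 2 f) {a : ℕ → ℂ}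
    (ha : ∀ z ∈ Disc, HasSum (fun n => a n * z ^ n) (f z)) :
    ∑' n, ENNReal.ofReal (‖a n‖ ^ 2) ≤ ENNReal.ofReal (hardyNorm 2 f ^ 2) := by
  rw [hardyNorm_two_sq]
  refine ENNReal.tsum_le_of_sum_range_le fun N => ?_
  rw [← ENNReal.ofReal_sum_of_nonneg fun _ _ => by positivity]
  refine ENNReal.ofReal_le_ofReal ?_
  have hlim : Tendsto (fun r : ℝ => ∑ n ∈ Finset.range N, ‖a n‖ ^ 2 * (r ^ 2) ^ n)
      (nhdsWithin 1 (Set.Iio 1)) (nhds (∑ n ∈ Finset.range N, ‖a n‖ ^ 2)) := by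
    have : Continuous fun r : ℝ => ∑ n ∈ Finset.range N, ‖a n‖ ^ 2 * (r ^ 2) ^ n := by fun_prop
    simpa using (this.tendsto 1).mono_left nhdsWithin_le_nhds
  refine le_of_tendsto hlim ?_
  filter_upwards [Ioo_mem_nhdsLT (zero_lt_one' ℝ)] with r hr
  have hs := hasSum_hardyMean ha hr
  exact (hs.summable.sum_le_tsum _ fun _ _ => by positivity).trans
    (hs.tsum_eq ▸ le_csSup hf.2 ⟨r, hr, rfl⟩)

/-- The square root of the kernel in the second condition, whose Hardy norm is at most one. -/
theorem memHardy_kernel {w : ℂ} (hw : w ∈ Disc) :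
    MemHardy 2 (fun z => (Real.sqrt (1 - ‖w‖ ^ 2) : ℂ) / (1 - conj w * z)) ∧
      hardyNorm 2 (fun z => (Real.sqrt (1 - ‖w‖ ^ 2) : ℂ) / (1 - conj w * z)) ^ 2 ≤ 1 := by
  have hw1 : ‖w‖ < 1 := mem_ball_zero_iff.1 hw
  have hw2 : ‖w‖ ^ 2 < 1 := by nlinarith [norm_nonneg w]
  have hlt : ∀ z ∈ Disc, ‖conj w * z‖ < 1 := fun z hz => by
    rw [norm_mul, RCLike.norm_conj]
    exact mul_lt_one_of_nonneg_of_lt_one_left (norm_nonneg _) hw1 (mem_ball_zero_iff.1 hz).le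
  have hmean : ∀ x ∈ hardyMean 2 (fun z => (Real.sqrt (1 - ‖w‖ ^ 2) : ℂ) / (1 - conj w * z)) ''
      Set.Ioo (0 : ℝ) 1, x ≤ 1 := by
    rintro _ ⟨r, hr, rfl⟩
    have hs := hasSum_hardyMean (a := fun n => (Real.sqrt (1 - ‖w‖ ^ 2) : ℂ) * conj w ^ n)
      (fun z hz => by
        simpa [mul_pow, mul_assoc, div_eq_mul_inv] using
          (hasSum_geometric_of_norm_lt_one (hlt z hz)).mul_left (Real.sqrt (1 - ‖w‖ ^ 2) : ℂ)) hr
    have hgeo := (hasSum_geometric_of_lt_one (sq_nonneg ‖w‖) hw2).mul_left (1 - ‖w‖ ^ 2)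
    rw [mul_inv_cancel₀ (by linarith)] at hgeo
    refine hasSum_le (fun n => ?_) hs hgeo
    have he : ‖(Real.sqrt (1 - ‖w‖ ^ 2) : ℂ) * conj w ^ n‖ ^ 2 = (1 - ‖w‖ ^ 2) * (‖w‖ ^ 2) ^ n := by
      rw [norm_mul, norm_pow, RCLike.norm_conj, Complex.norm_real,
        Real.norm_of_nonneg (Real.sqrt_nonneg _), mul_pow, Real.sq_sqrt (by linarith)]
      ring
    rw [he]
    exact mul_le_of_le_one_right (mul_nonneg (by linarith) (by positivity))
      (pow_le_one₀ (by positivity) (pow_le_one₀ hr.1.le hr.2.le))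
  refine ⟨⟨?_, 1, hmean⟩, ?_⟩
  · refine (differentiableOn_const _).div (by fun_prop) fun z hz h => ?_
    rw [sub_eq_zero] at h
    simpa [← h] using hlt z hz
  · rw [hardyNorm_two_sq]
    exact Real.sSup_le hmean zero_le_one

/-! ### The Carleson embedding -/

/-- Row sums of the Hilbert matrix `1 / (n + m + 1)` against the weights `√(n + 1) / √(m + 1)`. -/
theorem sum_hilbert_weight_le (n N : ℕ) :
    ∑ m ∈ Finset.range N, √((n : ℝ) + 1) / √((m : ℝ) + 1) / ((n + m : ℕ) + 1) ≤ 8 := by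
  set a := √((n : ℝ) + 1) with ha
  have ha1 : 1 ≤ a := Real.one_le_sqrt.2 (by linarith [n.cast_nonneg (α := ℝ)])
  have ha2 : a ^ 2 = n + 1 := Real.sq_sqrt (by positivity)
  -- The terms are dominated by a telescoping sum, a discrete form of the substitution that
  -- computes `∫ dx / (√x (x + a²))`.
  let φ : ℕ → ℝ := fun m => 8 * (√(m : ℝ) / (√(m : ℝ) + a))
  have hstep : ∀ m : ℕ, a / √((m : ℝ) + 1) / ((n + m : ℕ) + 1) ≤ φ (m + 1) - φ m := by
    intro m
    simp only [φ]
    push_cast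
    set s := √((m : ℝ) + 1)
    set u := √(m : ℝ)
    have hs2 : s ^ 2 = m + 1 := Real.sq_sqrt (by positivity)
    have hu2 : u ^ 2 = m := Real.sq_sqrt (by positivity)
    have hu0 : 0 ≤ u := Real.sqrt_nonneg _
    have hs0 : 0 < s := Real.sqrt_pos.2 (by positivity)
    have hus : u ≤ s := Real.sqrt_le_sqrt (by linarith)
    have hprod : (s - u) * (s + u) = 1 := by linear_combination hs2 - hu2
    have hden : (n : ℝ) + m + 1 = u ^ 2 + a ^ 2 := by linarith
    have hdiff : 8 * (s / (s + a)) - 8 * (u / (u + a))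
        = 8 * a / ((s + a) * (u + a) * (s + u)) := by
      have h1 : s + a ≠ 0 := by positivity
      have h2 : u + a ≠ 0 := by positivity
      have h3 : s + u ≠ 0 := by positivity
      field_simp
      linear_combination a * hprod
    rw [hdiff, hden, div_div, div_le_div_iff₀ (by positivity) (by positivity)]
    have h4 : (s + a) * (u + a) ≤ 4 * (u ^ 2 + a ^ 2) := by
      nlinarith [sq_nonneg (s - u), sq_nonneg (s - a), sq_nonneg (u - a)]
    have h5 : (s + a) * (u + a) * (s + u) ≤ 4 * (u ^ 2 + a ^ 2) * (2 * s) :=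
      mul_le_mul h4 (by linarith) (by positivity) (by positivity)
    nlinarith
  calc _ ≤ ∑ m ∈ Finset.range N, (φ (m + 1) - φ m) := Finset.sum_le_sum fun m _ => hstep m
    _ = φ N - φ 0 := Finset.sum_range_sub φ N
    _ ≤ 8 := by
      have : √(N : ℝ) / (√(N : ℝ) + a) ≤ 1 := by
        rw [div_le_one (by positivity)]; linarith
      simp only [φ, Nat.cast_zero, Real.sqrt_zero, zero_div]; linarith

/-- The arithmetic-geometric mean step of Schur's test, in the symmetric double sum
`∑∑ bₙ bₘ tⁿ⁺ᵐ` with weights `√(n + 1)`. -/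
theorem sq_tsum_le_schur {b : ℕ → ℝ} (hb : ∀ n, 0 ≤ b n) {t : ℝ} (ht : 0 ≤ t)
    (hs : Summable fun n => b n * t ^ n) :
    ENNReal.ofReal ((∑' n, b n * t ^ n) ^ 2) ≤
      ∑' n, ∑' m : ℕ, ENNReal.ofReal (b n ^ 2 * (√((n : ℝ) + 1) / √((m : ℝ) + 1)) * t ^ (n + m)) := by
  have hnn : ∀ n, 0 ≤ b n * t ^ n := fun n => mul_nonneg (hb n) (pow_nonneg ht n)
  set G : ℕ → ℕ → ℝ≥0∞ := fun n m =>
    ENNReal.ofReal (b n ^ 2 * (√((n : ℝ) + 1) / √((m : ℝ) + 1)) * t ^ (n + m)) with hG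
  have hle : ∀ n m, ENNReal.ofReal (b n * t ^ n) * ENNReal.ofReal (b m * t ^ m)
      ≤ (G n m + G m n) / 2 := by
    intro n m
    rw [hG, ← ENNReal.ofReal_mul (hnn n), ← ENNReal.ofReal_add (by positivity) (by positivity),
      ← ENNReal.ofReal_ofNat, ← ENNReal.ofReal_div_of_pos two_pos]
    refine ENNReal.ofReal_le_ofReal ?_
    set p := √((n : ℝ) + 1)
    set q := √((m : ℝ) + 1)
    have hp : 0 < p := Real.sqrt_pos.2 (by positivity)
    have hq : 0 < q := Real.sqrt_pos.2 (by positivity)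
    have key : b n * b m ≤ (b n ^ 2 * (p / q) + b m ^ 2 * (q / p)) / 2 := by
      have : (b n ^ 2 * (p / q) + b m ^ 2 * (q / p)) / 2 - b n * b m
          = (b n * p - b m * q) ^ 2 / (2 * p * q) := by field_simp; ring
      have h0 : 0 ≤ (b n * p - b m * q) ^ 2 / (2 * p * q) := by positivity
      linarith
    calc b n * t ^ n * (b m * t ^ m) = b n * b m * t ^ (n + m) := by ring
      _ ≤ (b n ^ 2 * (p / q) + b m ^ 2 * (q / p)) / 2 * t ^ (n + m) := by gcongr
      _ = _ := by rw [add_comm m n]; ring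
  calc ENNReal.ofReal ((∑' n, b n * t ^ n) ^ 2)
      = ∑' n, ∑' m, ENNReal.ofReal (b n * t ^ n) * ENNReal.ofReal (b m * t ^ m) := by
        rw [sq, ENNReal.ofReal_mul (tsum_nonneg hnn), ENNReal.ofReal_tsum_of_nonneg hnn hs,
          ← ENNReal.tsum_mul_right]
        simp_rw [ENNReal.tsum_mul_left]
    _ ≤ ∑' n, ∑' m, (G n m + G m n) / 2 :=
        ENNReal.tsum_le_tsum fun n => ENNReal.tsum_le_tsum fun m => hle n m
    _ = ∑' n, ∑' m, G n m := by
        simp_rw [div_eq_mul_inv, ENNReal.tsum_mul_right, ENNReal.tsum_add]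
        rw [ENNReal.tsum_comm (f := fun n m => G m n), ← two_mul, mul_comm, ← mul_assoc,
          ENNReal.inv_mul_cancel two_ne_zero ENNReal.ofNat_ne_top, one_mul]

/-- Under the moment condition, `H²` embeds in `L²(μ)`: this is Hilbert's inequality for the
matrix of moments, proved by Schur's test. -/
theorem lintegral_sq_le {μ : Measure (Set.Ico (0 : ℝ) 1)} {C : ℝ} (hC : 0 < C)
    (hM : MomentBound μ C) {f : ℂ → ℂ} (hf : MemHardy 2 f) :
    ∫⁻ t : Set.Ico (0 : ℝ) 1, ENNReal.ofReal (‖f (t : ℝ)‖ ^ 2) ∂μ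
      ≤ ENNReal.ofReal (8 * C * hardyNorm 2 f ^ 2) := by
  obtain ⟨a, ha⟩ : ∃ a : ℕ → ℂ, ∀ z ∈ Disc, HasSum (fun n => a n * z ^ n) (f z) := by
    refine ⟨fun n => (n.factorial : ℂ)⁻¹ * iteratedDeriv n f 0, fun z hz => ?_⟩
    have := Complex.hasSum_taylorSeries_on_ball hf.1 hz
    simpa only [sub_zero, smul_eq_mul, mul_assoc, mul_comm (z ^ _)] using this
  have hdisc : ∀ t : Set.Ico (0 : ℝ) 1, ((t : ℝ) : ℂ) ∈ Disc := fun t => (icoToDisc t).2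
  have hpt : ∀ t : Set.Ico (0 : ℝ) 1, ENNReal.ofReal (‖f (t : ℝ)‖ ^ 2) ≤
      ∑' n, ∑' m : ℕ, ENNReal.ofReal
        (‖a n‖ ^ 2 * (√((n : ℝ) + 1) / √((m : ℝ) + 1)) * (t : ℝ) ^ (n + m)) := by
    intro t
    have hs := ha _ (hdisc t)
    have hn : ∀ n, ‖a n * ((t : ℝ) : ℂ) ^ n‖ = ‖a n‖ * (t : ℝ) ^ n := fun n => by
      rw [norm_mul, norm_pow, Complex.norm_real, Real.norm_of_nonneg t.2.1]
    have hsum : Summable fun n => ‖a n‖ * (t : ℝ) ^ n := by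
      simpa only [hn] using hs.summable.norm
    refine le_trans (ENNReal.ofReal_le_ofReal ?_)
      (sq_tsum_le_schur (fun n => norm_nonneg (a n)) t.2.1 hsum)
    gcongr
    rw [← hs.tsum_eq]
    refine (norm_tsum_le_tsum_norm hs.summable.norm).trans_eq ?_
    simp_rw [hn]
  have hmeas : ∀ (c : ℝ) (k : ℕ), Measurable fun t : Set.Ico (0 : ℝ) 1 =>
      ENNReal.ofReal (c * (t : ℝ) ^ k) := fun c k => by fun_prop
  calc _ ≤ ∫⁻ t : Set.Ico (0 : ℝ) 1, ∑' n, ∑' m : ℕ, ENNReal.ofReal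
          (‖a n‖ ^ 2 * (√((n : ℝ) + 1) / √((m : ℝ) + 1)) * (t : ℝ) ^ (n + m)) ∂μ :=
        lintegral_mono hpt
    _ = ∑' n, ∑' m : ℕ, ∫⁻ t : Set.Ico (0 : ℝ) 1, ENNReal.ofReal
          (‖a n‖ ^ 2 * (√((n : ℝ) + 1) / √((m : ℝ) + 1)) * (t : ℝ) ^ (n + m)) ∂μ := by
        rw [lintegral_tsum fun n => (Measurable.tsum fun m => hmeas _ _).aemeasurable]
        refine tsum_congr fun n => lintegral_tsum fun m => (hmeas _ _).aemeasurable
    _ ≤ ∑' n, ∑' m : ℕ, ENNReal.ofReal (C * ‖a n‖ ^ 2) *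
          ENNReal.ofReal (√((n : ℝ) + 1) / √((m : ℝ) + 1) / ((n + m : ℕ) + 1)) := by
        refine ENNReal.tsum_le_tsum fun n => ENNReal.tsum_le_tsum fun m => ?_
        have h0 : 0 ≤ ‖a n‖ ^ 2 * (√((n : ℝ) + 1) / √((m : ℝ) + 1)) := by positivity
        simp_rw [ENNReal.ofReal_mul h0]
        rw [lintegral_const_mul _ (by fun_prop)]
        refine (mul_le_mul_right (hM (n + m)) _).trans_eq ?_
        rw [← ENNReal.ofReal_mul h0, ← ENNReal.ofReal_mul (by positivity)]
        congr 1
        ring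
    _ ≤ ∑' n, ENNReal.ofReal (C * ‖a n‖ ^ 2) * ENNReal.ofReal 8 := by
        refine ENNReal.tsum_le_tsum fun n => ?_
        rw [ENNReal.tsum_mul_left]
        gcongr
        refine ENNReal.tsum_le_of_sum_range_le fun N => ?_
        rw [← ENNReal.ofReal_sum_of_nonneg fun _ _ => by positivity]
        exact ENNReal.ofReal_le_ofReal (sum_hilbert_weight_le n N)
    _ = ENNReal.ofReal (8 * C) * ∑' n, ENNReal.ofReal (‖a n‖ ^ 2) := by
        rw [← ENNReal.tsum_mul_left]
        refine tsum_congr fun n => ?_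
        rw [← ENNReal.ofReal_mul (by positivity), ← ENNReal.ofReal_mul (by positivity)]
        congr 1
        ring
    _ ≤ ENNReal.ofReal (8 * C) * ENNReal.ofReal (hardyNorm 2 f ^ 2) := by
        gcongr
        exact tsum_sq_coeff_le hf ha
    _ = _ := by rw [← ENNReal.ofReal_mul (by positivity)]

theorem isHankelMeasure_of_momentBound {μ : Measure (Set.Ico (0 : ℝ) 1)} {C : ℝ} (hC : 0 < C)
    (hM : MomentBound μ C) : IsHankelMeasure (toDisc μ) := by
  refine ⟨8 * C, by positivity, fun f hf => ?_⟩
  have hle := lintegral_sq_le hC hM hf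
  have hcont : Continuous fun z : Disc => f z ^ 2 :=
    (continuousOn_iff_continuous_domRestrict.1 hf.1.continuousOn).pow 2
  have hmeas : AEStronglyMeasurable (fun z : Disc => f z ^ 2) (toDisc μ) :=
    hcont.measurable.aestronglyMeasurable
  have henorm : ∫⁻ t, ‖f (icoToDisc t) ^ 2‖ₑ ∂μ ≤ ENNReal.ofReal (8 * C * hardyNorm 2 f ^ 2) := by
    refine le_trans (le_of_eq (lintegral_congr fun t => ?_)) hle
    rw [← ofReal_norm, norm_pow]
    rfl
  have hmeas' : AEStronglyMeasurable (fun t => f (icoToDisc t) ^ 2) μ :=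
    hmeas.comp_measurable measurable_icoToDisc
  constructor
  · exact (integrable_map_measure hmeas measurable_icoToDisc.aemeasurable).2
      ⟨hmeas', henorm.trans_lt ENNReal.ofReal_lt_top⟩
  · rw [toDisc, integral_map measurable_icoToDisc.aemeasurable hmeas]
    have := (enorm_integral_le_lintegral_enorm _).trans henorm
    rw [← ofReal_norm] at this
    exact (ENNReal.ofReal_le_ofReal_iff (by positivity)).1 this

/-! ### Testing the Hankel condition on kernels -/

theorem kernel_bounded_of_isHankelMeasure {μ : Measure (Set.Ico (0 : ℝ) 1)}
    (h : IsHankelMeasure (toDisc μ)) :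
    (∀ w ∈ Disc, Integrable (fun t : Set.Ico (0 : ℝ) 1 =>
          (1 - (‖w‖ : ℂ) ^ 2) / (1 - conj w * ((t : ℝ) : ℂ)) ^ 2) μ) ∧
        BddAbove ((fun w : ℂ => ‖∫ t : Set.Ico (0 : ℝ) 1,
          (1 - (‖w‖ : ℂ) ^ 2) / (1 - conj w * ((t : ℝ) : ℂ)) ^ 2 ∂μ‖) '' Disc) := by
  obtain ⟨C, hC, h⟩ := h
  have key : ∀ w ∈ Disc, Integrable (fun t : Set.Ico (0 : ℝ) 1 =>
      (1 - (‖w‖ : ℂ) ^ 2) / (1 - conj w * ((t : ℝ) : ℂ)) ^ 2) μ ∧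
      ‖∫ t : Set.Ico (0 : ℝ) 1,
          (1 - (‖w‖ : ℂ) ^ 2) / (1 - conj w * ((t : ℝ) : ℂ)) ^ 2 ∂μ‖ ≤ C := by
    intro w hw
    obtain ⟨hm, hn⟩ := memHardy_kernel hw
    have hw2 : 0 ≤ 1 - ‖w‖ ^ 2 := by
      have := mem_ball_zero_iff.1 hw
      nlinarith [norm_nonneg w]
    have hsq : ((Real.sqrt (1 - ‖w‖ ^ 2) : ℝ) : ℂ) ^ 2 = 1 - (‖w‖ : ℂ) ^ 2 := by
      rw [← Complex.ofReal_pow, Real.sq_sqrt hw2]; push_cast; rfl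
    obtain ⟨hi, hb⟩ := h _ hm
    simp only [div_pow, hsq] at hi hb
    refine ⟨hi.comp_measurable measurable_icoToDisc, ?_⟩
    rw [toDisc, integral_map measurable_icoToDisc.aemeasurable hi.1] at hb
    exact hb.trans (mul_le_of_le_one_right hC.le hn)
  refine ⟨fun w hw => (key w hw).1, C, ?_⟩
  rintro _ ⟨w, hw, rfl⟩
  exact (key w hw).2

theorem moments_of_kernel_bounded {μ : Measure (Set.Ico (0 : ℝ) 1)}
    (hi : ∀ w ∈ Disc, Integrable (fun t : Set.Ico (0 : ℝ) 1 =>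
          (1 - (‖w‖ : ℂ) ^ 2) / (1 - conj w * ((t : ℝ) : ℂ)) ^ 2) μ)
    (hb : BddAbove ((fun w : ℂ => ‖∫ t : Set.Ico (0 : ℝ) 1,
          (1 - (‖w‖ : ℂ) ^ 2) / (1 - conj w * ((t : ℝ) : ℂ)) ^ 2 ∂μ‖) '' Disc)) :
    (∀ n : ℕ, Integrable (fun t : Set.Ico (0 : ℝ) 1 => (t : ℝ) ^ n) μ) ∧
        moment μ =O[atTop] (fun n : ℕ => 1 / (n : ℝ)) := by
  have : IsFiniteMeasure μ := by
    have := hi 0 (by simp)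
    simpa [integrable_const_iff] using this
  refine ⟨integrable_pow μ, ?_⟩
  obtain ⟨C, hC⟩ := hb
  have hpow : ∀ n : ℕ, (n + 1) * moment μ n ≤ 2 * C := by
    intro n
    have hn : (0 : ℝ) < n + 1 := by positivity
    have hw := testRadius_mem n
    set r : ℝ := n / (n + 1) with hr
    have hr0 : 0 ≤ r := by positivity
    have hCr := hC ⟨_, hw, rfl⟩
    have hir := hi _ hw
    have hform : ∀ t : Set.Ico (0 : ℝ) 1,
        (1 - (‖(r : ℂ)‖ : ℂ) ^ 2) / (1 - conj (r : ℂ) * ((t : ℝ) : ℂ)) ^ 2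
          = (((1 - r ^ 2) * (1 / (1 - r * t) ^ 2) : ℝ) : ℂ) := by
      intro t
      rw [Complex.norm_real, Real.norm_of_nonneg hr0, Complex.conj_ofReal]
      push_cast
      ring
    simp only [hform] at hCr hir
    rw [integral_complex_ofReal, Complex.norm_real] at hCr
    have hir' : Integrable (fun t : Set.Ico (0 : ℝ) 1 => (1 - r ^ 2) * (1 / (1 - r * t) ^ 2)) μ := by
      simpa only [RCLike.re_eq_complex_re, Complex.ofReal_re] using hir.re
    have hmono : ∫ t : Set.Ico (0 : ℝ) 1, (n + 1) / 2 * (t : ℝ) ^ n ∂μ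
        ≤ ∫ t : Set.Ico (0 : ℝ) 1, (1 - r ^ 2) * (1 / (1 - r * t) ^ 2) ∂μ := by
      refine integral_mono ((integrable_pow μ n).const_mul _) hir' fun t => ?_
      have hk := pow_le_kernel n t.2.1 t.2.2.le
      have h1 : 1 / (n + 1) ≤ 1 - r ^ 2 := by
        have : 1 - r = 1 / (n + 1) := by rw [hr]; field_simp; ring
        have h' : 0 ≤ 1 - r := by rw [this]; positivity
        nlinarith
      calc (n + 1) / 2 * (t : ℝ) ^ n = 1 / (n + 1) * ((n + 1 : ℝ) ^ 2 * (t : ℝ) ^ n / 2) := by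
            field_simp
        _ ≤ _ := by
          refine mul_le_mul h1 hk ?_ (le_trans (by positivity) h1)
          have := pow_nonneg t.2.1 n
          positivity
    rw [integral_const_mul] at hmono
    change (n + 1) / 2 * moment μ n ≤ _ at hmono
    have := hmono.trans ((le_abs_self _).trans hCr)
    linarith
  refine moment_isBigO_of_le μ (C := 2 * C) fun n => le_trans ?_ (hpow (n + 1))
  have : 0 ≤ moment μ (n + 1) := integral_nonneg fun t => pow_nonneg t.2.1 _
  push_cast
  nlinarith

/-! ### The Cauchy transform on the segment and its derivative -/

theorem aestronglyMeasurable_cauchyKernel (ν : Measure Disc) (w : ℂ) :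
    AEStronglyMeasurable (fun z : Disc => 1 / (1 - w * conj (z : ℂ))) ν := by
  have : Measurable fun z : Disc => conj (z : ℂ) :=
    Complex.continuous_conj.measurable.comp measurable_subtype_coe
  exact (measurable_const.div (measurable_const.sub (this.const_mul w))).aestronglyMeasurable

theorem cauchyTransform_toDisc (μ : Measure (Set.Ico (0 : ℝ) 1)) (w : ℂ) :
    cauchyTransform (toDisc μ) w
      = ∫ t : Set.Ico (0 : ℝ) 1, 1 / (1 - w * ((t : ℝ) : ℂ)) ∂μ := by
  rw [cauchyTransform, toDisc, integral_map measurable_icoToDisc.aemeasurable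
    (aestronglyMeasurable_cauchyKernel _ w)]
  simp [icoToDisc]

theorem one_sub_norm_le (w : ℂ) (t : Set.Ico (0 : ℝ) 1) :
    1 - ‖w‖ ≤ ‖1 - w * ((t : ℝ) : ℂ)‖ := by
  have h := norm_sub_norm_le (1 : ℂ) (w * ((t : ℝ) : ℂ))
  rw [norm_one, norm_mul, Complex.norm_real, Real.norm_of_nonneg t.2.1] at h
  have := mul_le_of_le_one_right (norm_nonneg w) t.2.2.le
  linarith

theorem cauchyTransformExists_iff (μ : Measure (Set.Ico (0 : ℝ) 1)) :
    CauchyTransformExists (toDisc μ) ↔ IsFiniteMeasure μ := by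
  constructor
  · intro h
    have h0 := (h 0 (by simp)).comp_measurable measurable_icoToDisc
    simpa [Function.comp_def, integrable_const_iff] using h0
  · intro _ w hw
    have hw1 : 0 < 1 - ‖w‖ := by linarith [mem_ball_zero_iff.1 hw]
    refine (integrable_map_measure (aestronglyMeasurable_cauchyKernel _ w)
      measurable_icoToDisc.aemeasurable).2 (Integrable.of_bound (C := 1 / (1 - ‖w‖))
      ((aestronglyMeasurable_cauchyKernel _ w).comp_measurable measurable_icoToDisc)
      (ae_of_all _ fun t => ?_))
    have := one_sub_norm_le w t
    simp only [Function.comp_apply, icoToDisc, Complex.conj_ofReal, norm_div, norm_one]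
    gcongr

theorem hasDerivAt_cauchyTransform (μ : Measure (Set.Ico (0 : ℝ) 1)) [IsFiniteMeasure μ]
    {z : ℂ} (hz : z ∈ Disc) :
    Integrable (fun t : Set.Ico (0 : ℝ) 1 => ((t : ℝ) : ℂ) / (1 - z * ((t : ℝ) : ℂ)) ^ 2) μ ∧
    HasDerivAt (cauchyTransform (toDisc μ))
      (∫ t : Set.Ico (0 : ℝ) 1, ((t : ℝ) : ℂ) / (1 - z * ((t : ℝ) : ℂ)) ^ 2 ∂μ) z := by
  have hz1 : ‖z‖ < 1 := mem_ball_zero_iff.1 hz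
  set δ : ℝ := (1 - ‖z‖) / 2 with hδ
  have hδ0 : 0 < δ := by linarith
  have hfun : cauchyTransform (toDisc μ)
      = fun w => ∫ t : Set.Ico (0 : ℝ) 1, 1 / (1 - w * ((t : ℝ) : ℂ)) ∂μ :=
    funext (cauchyTransform_toDisc μ)
  have hmeas : Measurable fun t : Set.Ico (0 : ℝ) 1 => ((t : ℝ) : ℂ) :=
    Complex.measurable_ofReal.comp measurable_subtype_coe
  have hden : ∀ w ∈ Metric.ball z δ, ∀ t : Set.Ico (0 : ℝ) 1, δ ≤ ‖1 - w * ((t : ℝ) : ℂ)‖ := by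
    intro w hw t
    have h1 := one_sub_norm_le w t
    have h2 : ‖w‖ - ‖z‖ ≤ ‖w - z‖ := norm_sub_norm_le w z
    have h3 : ‖w - z‖ < δ := mem_ball_iff_norm.1 hw
    linarith
  have hm1 : ∀ w : ℂ, AEStronglyMeasurable
      (fun t : Set.Ico (0 : ℝ) 1 => 1 / (1 - w * ((t : ℝ) : ℂ))) μ := fun w =>
    (measurable_const.div (measurable_const.sub (hmeas.const_mul w))).aestronglyMeasurable
  rw [hfun]
  refine hasDerivAt_integral_of_dominated_loc_of_deriv_le (Metric.ball_mem_nhds z hδ0)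
    (F := fun w (t : Set.Ico (0 : ℝ) 1) => 1 / (1 - w * ((t : ℝ) : ℂ)))
    (F' := fun w (t : Set.Ico (0 : ℝ) 1) => ((t : ℝ) : ℂ) / (1 - w * ((t : ℝ) : ℂ)) ^ 2)
    (bound := fun _ => 1 / δ ^ 2) (Eventually.of_forall hm1) ?_
    (hmeas.div ((measurable_const.sub (hmeas.const_mul z)).pow_const 2)).aestronglyMeasurable
    (ae_of_all _ fun t w hw => ?_) (integrable_const _) (ae_of_all _ fun t w hw => ?_)
  · refine Integrable.of_bound (C := 1 / δ) (hm1 z) (ae_of_all _ fun t => ?_)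
    rw [norm_div, norm_one]
    exact one_div_le_one_div_of_le hδ0 (hden z (Metric.mem_ball_self hδ0) t)
  · rw [norm_div, norm_pow, Complex.norm_real, Real.norm_of_nonneg t.2.1]
    have := hden w hw t
    have := t.2.2.le
    gcongr
  · have hne : 1 - w * ((t : ℝ) : ℂ) ≠ 0 := norm_pos_iff.1 (hδ0.trans_le (hden w hw t))
    have := (((hasDerivAt_id w).mul_const ((t : ℝ) : ℂ)).const_sub 1).inv hne
    simp only [one_div]
    convert! this using 1
    simp

theorem differentiableOn_cauchyTransform (μ : Measure (Set.Ico (0 : ℝ) 1)) [IsFiniteMeasure μ] :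
    DifferentiableOn ℂ (cauchyTransform (toDisc μ)) Disc := fun _ hz =>
  (hasDerivAt_cauchyTransform μ hz).2.differentiableAt.differentiableWithinAt

/-! ### Testing `Q_p` at real points -/

theorem re_inv_sq_ge {A : ℝ} (hA : 0 < A) {u : ℂ} (hu : ‖u‖ ≤ A / 4) :
    1 / (5 * A ^ 2) ≤ (1 / ((A : ℂ) - u) ^ 2).re := by
  set v : ℂ := (A : ℂ) - u with hv
  have hre := (Complex.abs_re_le_norm u).trans hu
  have him := (Complex.abs_im_le_norm u).trans hu
  rw [abs_le] at hre him
  have hvre : v.re = A - u.re := by simp [hv]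
  have hvim : v.im = -u.im := by simp [hv]
  have hn : Complex.normSq v = v.re ^ 2 + v.im ^ 2 := by rw [Complex.normSq_apply]; ring
  have hsq : (v ^ 2).re = v.re ^ 2 - v.im ^ 2 := by simp [sq]
  have h1 : A ^ 2 / 2 ≤ v.re ^ 2 - v.im ^ 2 := by
    rw [hvre, hvim]; nlinarith
  have hpos : 0 < Complex.normSq v := by rw [hn]; nlinarith [sq_nonneg v.im]
  have h2 : Complex.normSq v ≤ 25 / 16 * A ^ 2 := by
    have h3 : ‖v‖ ≤ 5 / 4 * A := by
      have := norm_sub_le (A : ℂ) u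
      rw [Complex.norm_real, Real.norm_of_nonneg hA.le] at this
      linarith
    rw [Complex.normSq_eq_norm_sq]
    nlinarith [norm_nonneg v]
  rw [one_div (_ ^ 2 : ℂ), Complex.inv_re, hsq, map_pow, div_le_div_iff₀ (by positivity) (by positivity)]
  have h4 : Complex.normSq v ^ 2 ≤ (25 / 16 * A ^ 2) ^ 2 := by gcongr
  nlinarith [sq_nonneg (A ^ 2), mul_le_mul_of_nonneg_right h1 (by positivity : 0 ≤ 5 * A ^ 2)]

/-- On the disc of radius `(1 - r) / 4` about `r = n / (n + 1)` the integrand of `P_μ'` has real part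
bounded below by a power of `t`. -/
theorem pow_le_re_kernel (n : ℕ) {z : ℂ}
    (hz : ‖z - ((n / (n + 1) : ℝ) : ℂ)‖ ≤ 1 / (n + 1) / 4) (t : Set.Ico (0 : ℝ) 1) :
    (n + 1 : ℝ) ^ 2 / 10 * (t : ℝ) ^ (n + 1)
      ≤ (((t : ℝ) : ℂ) / (1 - z * ((t : ℝ) : ℂ)) ^ 2).re := by
  set r : ℝ := n / (n + 1) with hr
  have hn : (0 : ℝ) < n + 1 := by positivity
  have ht0 := t.2.1
  have ht1 := t.2.2.le
  set A : ℝ := 1 - r * t with hA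
  have hAh : 1 / (n + 1) ≤ A := by
    rw [hA, hr, one_sub_testRadius_mul]
    gcongr
    have : 0 ≤ (n : ℝ) * (1 - t) := mul_nonneg n.cast_nonneg (by linarith)
    linarith
  have hA0 : 0 < A := lt_of_lt_of_le (by positivity) hAh
  have hu : ‖(z - (r : ℂ)) * ((t : ℝ) : ℂ)‖ ≤ A / 4 := by
    rw [norm_mul, Complex.norm_real, Real.norm_of_nonneg ht0]
    have := mul_le_of_le_one_right (norm_nonneg (z - (r : ℂ))) ht1
    linarith
  have hre := re_inv_sq_ge hA0 hu
  have heq : (A : ℂ) - (z - (r : ℂ)) * ((t : ℝ) : ℂ) = 1 - z * ((t : ℝ) : ℂ) := by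
    rw [hA]; push_cast; ring
  rw [heq] at hre
  have hk := pow_le_kernel n ht0 ht1
  rw [← hr, ← hA] at hk
  rw [div_eq_mul_one_div ((t : ℝ) : ℂ), Complex.re_ofReal_mul]
  calc (n + 1 : ℝ) ^ 2 / 10 * (t : ℝ) ^ (n + 1)
      = t * (((n + 1 : ℝ) ^ 2 * (t : ℝ) ^ n / 2) / 5) := by ring
    _ ≤ t * ((1 / A ^ 2) / 5) := by gcongr
    _ = t * (1 / (5 * A ^ 2)) := by rw [div_div, mul_comm (A ^ 2)]
    _ ≤ _ := by gcongr

/-- Near the test radius the derivative of `P_μ` is bounded below by a moment, because the kernels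
`1 / (1 - z t)²` all have positive real part there. -/
theorem moment_le_norm_deriv (μ : Measure (Set.Ico (0 : ℝ) 1)) [IsFiniteMeasure μ] (n : ℕ) {z : ℂ}
    (hzD : z ∈ Disc) (hz : ‖z - ((n / (n + 1) : ℝ) : ℂ)‖ ≤ 1 / (n + 1) / 4) :
    (n + 1 : ℝ) ^ 2 / 10 * moment μ (n + 1) ≤ ‖deriv (cauchyTransform (toDisc μ)) z‖ := by
  obtain ⟨hi, hd⟩ := hasDerivAt_cauchyTransform μ hzD
  rw [hd.deriv]
  refine le_trans ?_ (Complex.re_le_norm _)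
  have hre := integral_re hi
  simp only [RCLike.re_eq_complex_re] at hre
  rw [← hre, moment, ← integral_const_mul]
  exact integral_mono ((integrable_pow μ (n + 1)).const_mul _) hi.re
    fun t => pow_le_re_kernel n hz t

theorem areaMeasure_ball {c : ℂ} {s : ℝ} (hs : 0 ≤ s) (h : Metric.ball c s ⊆ Disc) :
    areaMeasure (Metric.ball c s) = ENNReal.ofReal (s ^ 2) := by
  rw [areaMeasure, Measure.smul_apply, Measure.restrict_apply Metric.isOpen_ball.measurableSet,
    Set.inter_eq_left.2 h, Complex.volume_ball, smul_eq_mul, ENNReal.ofReal_pow hs,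
    mul_comm, mul_assoc]
  have : (NNReal.pi : ℝ≥0∞) = ENNReal.ofReal Real.pi := by
    rw [← NNReal.coe_real_pi, ENNReal.ofReal_coe_nnreal]
  rw [this, ENNReal.mul_inv_cancel (by simpa using Real.pi_pos) ENNReal.ofReal_ne_top, mul_one]

theorem half_le_one_sub_mobius_sq (n : ℕ) {z : ℂ} (hzD : z ∈ Disc)
    (hz : ‖z - ((n / (n + 1) : ℝ) : ℂ)‖ ≤ 1 / (n + 1) / 4) :
    1 / 2 ≤ 1 - ‖mobius ((n / (n + 1) : ℝ) : ℂ) z‖ ^ 2 := by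
  set r : ℝ := n / (n + 1) with hr
  have hn : (0 : ℝ) < n + 1 := by positivity
  have hr0 : 0 ≤ r := by positivity
  have h1r : 1 - r = 1 / (n + 1) := by rw [hr]; field_simp; ring
  have hden : 1 / (n + 1) ≤ ‖1 - conj (r : ℂ) * z‖ := by
    have h := norm_sub_norm_le (1 : ℂ) (conj (r : ℂ) * z)
    rw [norm_one, norm_mul, RCLike.norm_conj, Complex.norm_real, Real.norm_of_nonneg hr0] at h
    have := mul_le_of_le_one_right hr0 (mem_ball_zero_iff.1 hzD).le
    linarith
  have hσ : ‖mobius (r : ℂ) z‖ ≤ 1 / 4 := by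
    rw [mobius, norm_div, div_le_iff₀ (lt_of_lt_of_le (by positivity) hden), norm_sub_rev]
    linarith
  nlinarith [norm_nonneg (mobius (r : ℂ) z)]

/-- The seminorm is tested at `a = n / (n + 1)`, keeping only a disc of radius `1 / (4 (n + 1))`,
whose normalized area is the square of its radius. -/
theorem moments_of_memQ {μ : Measure (Set.Ico (0 : ℝ) 1)} [IsFiniteMeasure μ] {p : ℝ} (hp : 0 < p)
    (h : MemQ p (cauchyTransform (toDisc μ))) :
    moment μ =O[atTop] (fun n : ℕ => 1 / (n : ℝ)) := by
  set P := cauchyTransform (toDisc μ)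
  set K : ℝ≥0∞ := ⨆ a ∈ Disc, ∫⁻ z, ENNReal.ofReal (‖deriv P z‖ ^ 2 * (1 - ‖mobius a z‖ ^ 2) ^ p)
      ∂areaMeasure with hK
  have hKlt : K < ∞ := h.2
  refine moment_isBigO_of_le μ (C := √(1600 * 2 ^ p * K.toReal)) fun n => ?_
  have hn : (0 : ℝ) < n + 1 := by positivity
  set m := moment μ (n + 1)
  have hm0 : 0 ≤ m := integral_nonneg fun t => pow_nonneg t.2.1 _
  set r : ℝ := n / (n + 1) with hr
  set s : ℝ := 1 / (n + 1) / 4 with hs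
  have hs0 : 0 < s := by positivity
  have hball : Metric.ball (r : ℂ) s ⊆ Disc := by
    refine Metric.ball_subset_ball' ?_
    have hr0 : 0 ≤ r := by positivity
    have h1r : 1 - r = 1 / (n + 1) := by rw [hr]; field_simp; ring
    have : 0 < 1 / (n + 1 : ℝ) := by positivity
    rw [dist_zero_right, Complex.norm_real, Real.norm_of_nonneg hr0]
    linarith
  set c : ℝ := ((n + 1 : ℝ) ^ 2 / 10 * m) ^ 2 * (1 / 2) ^ p
  have hlow : ENNReal.ofReal (c * s ^ 2) ≤ K := by
    calc ENNReal.ofReal (c * s ^ 2)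
        = ∫⁻ _ in Metric.ball (r : ℂ) s, ENNReal.ofReal c ∂areaMeasure := by
          rw [setLIntegral_const, areaMeasure_ball hs0.le hball, ENNReal.ofReal_mul (by positivity)]
      _ ≤ ∫⁻ z in Metric.ball (r : ℂ) s,
            ENNReal.ofReal (‖deriv P z‖ ^ 2 * (1 - ‖mobius (r : ℂ) z‖ ^ 2) ^ p) ∂areaMeasure := by
          refine setLIntegral_mono' Metric.isOpen_ball.measurableSet fun z hz => ?_
          have hz' := (mem_ball_iff_norm.1 hz).le
          have h1 := moment_le_norm_deriv μ n (hball hz) hz'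
          have h2 := half_le_one_sub_mobius_sq n (hball hz) hz'
          refine ENNReal.ofReal_le_ofReal ?_
          exact mul_le_mul (pow_le_pow_left₀ (by positivity) h1 2)
            (Real.rpow_le_rpow (by norm_num) h2 hp.le) (by positivity) (by positivity)
      _ ≤ ∫⁻ z, ENNReal.ofReal (‖deriv P z‖ ^ 2 * (1 - ‖mobius (r : ℂ) z‖ ^ 2) ^ p)
            ∂areaMeasure := setLIntegral_le_lintegral _ _
      _ ≤ K := le_iSup₂_of_le (r : ℂ) (testRadius_mem n) le_rfl
  have hreal := (ENNReal.ofReal_le_iff_le_toReal hKlt.ne).1 hlow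
  refine Real.le_sqrt_of_sq_le ?_
  have h2p : (0 : ℝ) < 2 ^ p := by positivity
  have hc : ((n + 1) * m) ^ 2 = 1600 * 2 ^ p * (c * s ^ 2) := by
    have : (1 / 2 : ℝ) ^ p = (2 ^ p)⁻¹ := by rw [one_div, Real.inv_rpow two_pos.le]
    simp only [c, hs, this]
    field_simp
    ring
  rw [hc]
  gcongr

/-! ### The conformal weight near the point `1` -/

theorem one_sub_norm_mobius_sq (a z : ℂ) (h : 1 - conj a * z ≠ 0) :
    1 - ‖mobius a z‖ ^ 2 = (1 - ‖a‖ ^ 2) * (1 - ‖z‖ ^ 2) / ‖1 - conj a * z‖ ^ 2 := by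
  have h0 : ‖1 - conj a * z‖ ^ 2 ≠ 0 := by simpa using h
  rw [mobius, norm_div, div_pow, eq_div_iff h0, sub_mul, div_mul_cancel₀ _ h0, one_mul]
  simp only [← Complex.normSq_eq_norm_sq, Complex.normSq_apply]
  simp
  ring

/-- With `ρ = |1 - z|` and `d = |1 - a|`, the weight `1 - |σ_a(z)|²` is at most a constant times
`ρ / d` and at most the same constant times `d / ρ`. -/
theorem one_sub_mobius_sq_le {a z : ℂ} (ha : a ∈ Disc) (hz : z ∈ Disc) :
    0 ≤ 1 - ‖mobius a z‖ ^ 2 ∧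
      1 - ‖mobius a z‖ ^ 2 ≤ 16 * min (‖1 - z‖ / ‖1 - a‖) (‖1 - a‖ / ‖1 - z‖) := by
  have ha1 : ‖a‖ < 1 := mem_ball_zero_iff.1 ha
  have hz1 : ‖z‖ < 1 := mem_ball_zero_iff.1 hz
  set d := ‖1 - a‖ with hd
  set ρ := ‖1 - z‖ with hρ
  set D := ‖1 - conj a * z‖ with hD
  have hdist : ∀ x : ℂ, 1 - ‖x‖ ≤ ‖1 - x‖ := fun x => by simpa using norm_sub_norm_le (1 : ℂ) x
  have had : 1 - ‖a‖ ≤ d := hdist a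
  have hzρ : 1 - ‖z‖ ≤ ρ := hdist z
  have hd0 : 0 < d := by linarith
  have hρ0 : 0 < ρ := by linarith
  have hprod : ‖conj a * z‖ < 1 := by
    rw [norm_mul, RCLike.norm_conj]
    exact mul_lt_one_of_nonneg_of_lt_one_left (norm_nonneg _) ha1 hz1.le
  have hD0 : 0 < D := lt_of_lt_of_le (by linarith) (hdist (conj a * z))
  have hid := one_sub_norm_mobius_sq a z (norm_pos_iff.1 hD0)
  have hA : 0 ≤ 1 - ‖a‖ ^ 2 := by nlinarith [norm_nonneg a]
  have hZ : 0 ≤ 1 - ‖z‖ ^ 2 := by nlinarith [norm_nonneg z]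
  have hA2 : 1 - ‖a‖ ^ 2 ≤ 2 * d := by nlinarith [norm_nonneg a]
  have hZ2 : 1 - ‖z‖ ^ 2 ≤ 2 * ρ := by nlinarith [norm_nonneg z]
  have hone : 1 - ‖mobius a z‖ ^ 2 ≤ 1 := by nlinarith [sq_nonneg ‖mobius a z‖]
  have hquot : 1 - ‖mobius a z‖ ^ 2 ≤ 4 * d * ρ / D ^ 2 := by
    have : (1 - ‖a‖ ^ 2) * (1 - ‖z‖ ^ 2) ≤ 4 * d * ρ := by
      calc (1 - ‖a‖ ^ 2) * (1 - ‖z‖ ^ 2) ≤ (2 * d) * (2 * ρ) := by gcongr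
        _ = 4 * d * ρ := by ring
    rw [hid]
    exact div_le_div_of_nonneg_right this (by positivity)
  have hconj : ‖1 - conj a‖ = d := by rw [hd, ← RCLike.norm_conj (1 - a)]; simp
  have hD1 : d - ρ ≤ D := by
    have h := norm_sub_norm_le (1 - conj a) (-(conj a * (1 - z)))
    rw [hconj, norm_neg, norm_mul, RCLike.norm_conj] at h
    rw [show (1 - conj a) - -(conj a * (1 - z)) = 1 - conj a * z by ring] at h
    have := mul_le_of_le_one_left hρ0.le ha1.le
    linarith
  have hD2 : ρ - d ≤ D := by
    have h := norm_sub_norm_le (1 - z) (-(z * (1 - conj a)))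
    rw [norm_neg, norm_mul, hconj] at h
    rw [show (1 - z) - -(z * (1 - conj a)) = 1 - conj a * z by ring] at h
    have := mul_le_of_le_one_left hd0.le hz1.le
    linarith
  refine ⟨by rw [hid]; positivity, ?_⟩
  rw [mul_min_of_nonneg _ _ (by norm_num : (0 : ℝ) ≤ 16)]
  refine le_min ?_ ?_
  · rcases le_total d (2 * ρ) with h | h
    · refine hone.trans ?_
      rw [← mul_div_assoc, le_div_iff₀ hd0]; linarith
    · refine hquot.trans ?_
      rw [← mul_div_assoc, div_le_div_iff₀ (by positivity) hd0]
      have h2 : (d / 2) ^ 2 ≤ D ^ 2 := by gcongr; linarith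
      nlinarith
  · rcases le_total ρ (2 * d) with h | h
    · refine hone.trans ?_
      rw [← mul_div_assoc, le_div_iff₀ hρ0]; linarith
    · refine hquot.trans ?_
      rw [← mul_div_assoc, div_le_div_iff₀ (by positivity) hρ0]
      have h2 : (ρ / 2) ^ 2 ≤ D ^ 2 := by gcongr; linarith
      nlinarith

/-- The one-dimensional integral is invariant under the scaling `ρ ↦ dρ`. -/
theorem lintegral_radial_le {p d : ℝ} (hp : 0 < p) (hd : 0 < d) :
    ∫⁻ ρ in Set.Ioi (0 : ℝ), ENNReal.ofReal ρ *
      ENNReal.ofReal ((ρ ^ 2)⁻¹ * (min (ρ / d) (d / ρ)) ^ p) ≤ ENNReal.ofReal (2 / p) := by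
  have hbd : ∀ ρ : ℝ, 0 < ρ → ∀ x : ℝ, min (ρ / d) (d / ρ) ≤ x → ENNReal.ofReal ρ *
      ENNReal.ofReal ((ρ ^ 2)⁻¹ * (min (ρ / d) (d / ρ)) ^ p) ≤ ENNReal.ofReal (ρ⁻¹ * x ^ p) := by
    intro ρ hρ x hx
    rw [← ENNReal.ofReal_mul hρ.le]
    refine ENNReal.ofReal_le_ofReal ?_
    have h0 : 0 ≤ min (ρ / d) (d / ρ) := by positivity
    calc ρ * ((ρ ^ 2)⁻¹ * (min (ρ / d) (d / ρ)) ^ p)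
        = ρ⁻¹ * (min (ρ / d) (d / ρ)) ^ p := by field_simp
      _ ≤ ρ⁻¹ * x ^ p := by gcongr
  have hdp : (0 : ℝ) < d ^ p := by positivity
  have hsmall : ∫⁻ ρ in Set.Ioc 0 d, ENNReal.ofReal ρ *
      ENNReal.ofReal ((ρ ^ 2)⁻¹ * (min (ρ / d) (d / ρ)) ^ p) ≤ ENNReal.ofReal (1 / p) := by
    have hint : IntegrableOn (fun ρ : ℝ => ρ ^ (p - 1)) (Set.Ioc 0 d) := by
      rw [← intervalIntegrable_iff_integrableOn_Ioc_of_le hd.le]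
      exact intervalIntegral.intervalIntegrable_rpow' (by linarith)
    calc _ ≤ ∫⁻ ρ in Set.Ioc 0 d, ENNReal.ofReal ((d ^ p)⁻¹ * ρ ^ (p - 1)) := by
          refine setLIntegral_mono' measurableSet_Ioc fun ρ hρ => ?_
          refine (hbd ρ hρ.1 _ (min_le_left _ _)).trans_eq ?_
          rw [Real.div_rpow hρ.1.le hd.le, Real.rpow_sub_one hρ.1.ne']
          congr 1
          field_simp
      _ = ENNReal.ofReal (1 / p) := by
          rw [← ofReal_integral_eq_lintegral_ofReal (hint.const_mul _)
            ((ae_restrict_mem measurableSet_Ioc).mono fun ρ hρ => by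
              have := hρ.1.le
              positivity), integral_const_mul, ← intervalIntegral.integral_of_le hd.le,
            integral_rpow (Or.inl (by linarith))]
          congr 1
          rw [sub_add_cancel, Real.zero_rpow hp.ne']
          field_simp
          ring
  have hlarge : ∫⁻ ρ in Set.Ioi d, ENNReal.ofReal ρ *
      ENNReal.ofReal ((ρ ^ 2)⁻¹ * (min (ρ / d) (d / ρ)) ^ p) ≤ ENNReal.ofReal (1 / p) := by
    calc _ ≤ ∫⁻ ρ in Set.Ioi d, ENNReal.ofReal (d ^ p * ρ ^ (-p - 1)) := by
          refine setLIntegral_mono' measurableSet_Ioi fun ρ hρ => ?_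
          have hρ0 : 0 < ρ := hd.trans hρ
          refine (hbd ρ hρ0 _ (min_le_right _ _)).trans_eq ?_
          rw [Real.div_rpow hd.le hρ0.le, Real.rpow_sub_one hρ0.ne', Real.rpow_neg hρ0.le]
          congr 1
          field_simp
      _ = ENNReal.ofReal (1 / p) := by
          rw [← ofReal_integral_eq_lintegral_ofReal
            ((integrableOn_Ioi_rpow_of_lt (by linarith) hd).const_mul _)
            ((ae_restrict_mem measurableSet_Ioi).mono fun ρ hρ => by
              have : 0 < ρ := hd.trans hρ
              positivity), integral_const_mul, integral_Ioi_rpow_of_lt (by linarith) hd]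
          congr 1
          rw [sub_add_cancel, Real.rpow_neg hd.le]
          field_simp
  rw [← Set.Ioc_union_Ioi_eq_Ioi hd.le]
  refine (lintegral_union_le _ _ _).trans ((add_le_add hsmall hlarge).trans_eq ?_)
  rw [← ENNReal.ofReal_add (by positivity) (by positivity)]
  congr 1
  ring

theorem lintegral_weight_le {p d : ℝ} (hp : 0 < p) (hd : 0 < d) :
    ∫⁻ z : ℂ, ENNReal.ofReal ((‖1 - z‖ ^ 2)⁻¹ * (min (‖1 - z‖ / d) (d / ‖1 - z‖)) ^ p)
      ≤ ENNReal.ofReal (2 / p) * ENNReal.ofReal (2 * Real.pi) := by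
  let k : ℝ → ℝ≥0∞ := fun ρ => ENNReal.ofReal ((ρ ^ 2)⁻¹ * (min (ρ / d) (d / ρ)) ^ p)
  have hk : Measurable k := by fun_prop
  calc ∫⁻ z : ℂ, k ‖1 - z‖ = ∫⁻ z : ℂ, k ‖z‖ :=
        lintegral_sub_left_eq_self (fun z : ℂ => k ‖z‖) 1
    _ = ∫⁻ q in Set.Ioi (0 : ℝ) ×ˢ Set.Ioo (-Real.pi) Real.pi, (ENNReal.ofReal q.1 * k q.1) * 1 := by
        rw [← Complex.lintegral_comp_polarCoord_symm, polarCoord_target]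
        refine setLIntegral_congr_fun (measurableSet_Ioi.prod measurableSet_Ioo) fun q hq => ?_
        simp only [smul_eq_mul, mul_one, Complex.norm_polarCoord_symm]
        rw [abs_of_pos hq.1]
    _ = (∫⁻ ρ in Set.Ioi (0 : ℝ), ENNReal.ofReal ρ * k ρ) * ENNReal.ofReal (2 * Real.pi) := by
        rw [Measure.volume_eq_prod, ← Measure.prod_restrict,
          lintegral_prod_mul (f := fun ρ => ENNReal.ofReal ρ * k ρ) (g := fun _ => 1)
            (by fun_prop) (by fun_prop)]
        simp [two_mul]
    _ ≤ _ := by gcongr; exact lintegral_radial_le hp hd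

/-! ### The moment condition controls every `Q_p` seminorm -/

/-- Expanding `(1 - t + δ)⁻²` in powers of `t` turns the moment bounds into a bound for the
integral of this kernel. -/
theorem lintegral_kernel_le {μ : Measure (Set.Ico (0 : ℝ) 1)} {C : ℝ} (hC : 0 < C)
    (hM : MomentBound μ C) {δ : ℝ} (hδ : 0 < δ) :
    ∫⁻ t : Set.Ico (0 : ℝ) 1, ENNReal.ofReal (1 / (1 - t + δ) ^ 2) ∂μ ≤ ENNReal.ofReal (C / δ) := by
  have h1δ : 0 < 1 + δ := by linarith
  set q : ℝ := 1 / (1 + δ) with hq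
  have hq0 : 0 < q := by positivity
  have hq1 : q < 1 := by rw [hq, div_lt_one h1δ]; linarith
  have hexp : ∀ t : Set.Ico (0 : ℝ) 1, ENNReal.ofReal (1 / (1 - t + δ) ^ 2)
      = ∑' n : ℕ, ENNReal.ofReal ((n + 1) * q ^ (n + 2) * (t : ℝ) ^ n) := by
    intro t
    have ht0 := t.2.1
    have ht1 := t.2.2
    have hx : ‖q * (t : ℝ)‖ < 1 := by
      rw [Real.norm_of_nonneg (by positivity)]
      exact mul_lt_one_of_nonneg_of_lt_one_left hq0.le hq1 ht1.le
    have hs := (hasSum_choose_mul_geometric_of_norm_lt_one 1 hx).mul_left (q ^ 2)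
    have hval : q ^ 2 * (1 / (1 - q * (t : ℝ)) ^ (1 + 1)) = 1 / (1 - t + δ) ^ 2 := by
      have h2 : 1 - t + δ ≠ 0 := by linarith
      have h3 : 1 - q * (t : ℝ) = (1 - t + δ) * q := by rw [hq]; field_simp; ring
      rw [h3]
      field_simp
      ring
    have hterm : ∀ n : ℕ, q ^ 2 * (((n + 1).choose 1 : ℕ) * (q * (t : ℝ)) ^ n)
        = (n + 1) * q ^ (n + 2) * (t : ℝ) ^ n := fun n => by
      rw [Nat.choose_one_right]; push_cast; ring
    simp only [hval, hterm] at hs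
    rw [← hs.tsum_eq]
    exact ENNReal.ofReal_tsum_of_nonneg (fun n => by positivity) hs.summable
  have hgeo := (hasSum_geometric_of_lt_one hq0.le hq1).mul_left (C * q ^ 2)
  calc _ = ∑' n : ℕ, ∫⁻ t : Set.Ico (0 : ℝ) 1,
          ENNReal.ofReal ((n + 1) * q ^ (n + 2) * (t : ℝ) ^ n) ∂μ := by
        simp_rw [hexp]
        exact lintegral_tsum fun n => by fun_prop
    _ ≤ ∑' n : ℕ, ENNReal.ofReal (C * q ^ 2 * q ^ n) := by
        refine ENNReal.tsum_le_tsum fun n => ?_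
        have h0 : 0 ≤ ((n : ℝ) + 1) * q ^ (n + 2) := by positivity
        simp_rw [ENNReal.ofReal_mul h0]
        rw [lintegral_const_mul _ (by fun_prop)]
        refine (mul_le_mul_right (hM n) _).trans_eq ?_
        rw [← ENNReal.ofReal_mul h0]
        congr 1
        field_simp
        ring
    _ = ENNReal.ofReal (C * q ^ 2 * (1 - q)⁻¹) := by
        rw [← hgeo.tsum_eq]
        exact (ENNReal.ofReal_tsum_of_nonneg (fun n => by positivity) hgeo.summable).symm
    _ ≤ ENNReal.ofReal (C / δ) := by
        refine ENNReal.ofReal_le_ofReal ?_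
        have : C * q ^ 2 * (1 - q)⁻¹ = C / δ * q := by
          have h1q : 1 - q = δ * q := by rw [hq]; field_simp; ring
          rw [h1q]
          field_simp
        rw [this]
        exact mul_le_of_le_one_right (by positivity) hq1.le

theorem norm_one_sub_mul_ge {z : ℂ} (hz : z ∈ Disc) (t : Set.Ico (0 : ℝ) 1) :
    (1 - t + ‖1 - z‖) / 3 ≤ ‖1 - z * ((t : ℝ) : ℂ)‖ := by
  have ht0 := t.2.1
  have hz1 : ‖z‖ < 1 := mem_ball_zero_iff.1 hz
  have h1 : 1 - (t : ℝ) ≤ ‖1 - z * ((t : ℝ) : ℂ)‖ := by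
    have h := norm_sub_norm_le (1 : ℂ) (z * ((t : ℝ) : ℂ))
    rw [norm_one, norm_mul, Complex.norm_real, Real.norm_of_nonneg ht0] at h
    have := mul_le_of_le_one_left ht0 hz1.le
    linarith
  have h2 : ‖1 - z‖ ≤ ‖1 - z * ((t : ℝ) : ℂ)‖ + (1 - t) := by
    have h := norm_sub_le (1 - z * ((t : ℝ) : ℂ)) (z * ((1 - t : ℝ) : ℂ))
    rw [show 1 - z * ((t : ℝ) : ℂ) - z * ((1 - t : ℝ) : ℂ) = 1 - z by push_cast; ring,
      norm_mul, Complex.norm_real, Real.norm_of_nonneg (by linarith [t.2.2])] at h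
    have := mul_le_of_le_one_left (by linarith [t.2.2] : 0 ≤ 1 - (t : ℝ)) hz1.le
    linarith
  linarith

/-- The derivative of `P_μ` is dominated by that of the logarithm with its singularity at `1`. -/
theorem norm_deriv_le {μ : Measure (Set.Ico (0 : ℝ) 1)} [IsFiniteMeasure μ] {C : ℝ} (hC : 0 < C)
    (hM : MomentBound μ C) {z : ℂ} (hz : z ∈ Disc) :
    ‖deriv (cauchyTransform (toDisc μ)) z‖ ≤ 9 * C / ‖1 - z‖ := by
  have hρ : 0 < ‖1 - z‖ := by
    rw [norm_pos_iff, sub_ne_zero]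
    rintro rfl
    simp at hz
  rw [(hasDerivAt_cauchyTransform μ hz).2.deriv,
    ← ENNReal.ofReal_le_ofReal_iff (by positivity), ofReal_norm]
  calc _ ≤ ∫⁻ t : Set.Ico (0 : ℝ) 1, ‖((t : ℝ) : ℂ) / (1 - z * ((t : ℝ) : ℂ)) ^ 2‖ₑ ∂μ :=
        enorm_integral_le_lintegral_enorm _
    _ ≤ ∫⁻ t : Set.Ico (0 : ℝ) 1, ENNReal.ofReal 9 *
          ENNReal.ofReal (1 / (1 - t + ‖1 - z‖) ^ 2) ∂μ := by
        refine lintegral_mono fun t => ?_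
        have h0 : 0 < 1 - (t : ℝ) + ‖1 - z‖ := by linarith [t.2.2]
        have hge := norm_one_sub_mul_ge hz t
        rw [← ofReal_norm, ← ENNReal.ofReal_mul (by norm_num)]
        refine ENNReal.ofReal_le_ofReal ?_
        rw [norm_div, norm_pow, Complex.norm_real, Real.norm_of_nonneg t.2.1]
        calc (t : ℝ) / ‖1 - z * ((t : ℝ) : ℂ)‖ ^ 2
            ≤ 1 / ((1 - t + ‖1 - z‖) / 3) ^ 2 := by
              have := t.2.2.le
              gcongr
          _ = 9 * (1 / (1 - t + ‖1 - z‖) ^ 2) := by field_simp; norm_num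
    _ ≤ ENNReal.ofReal 9 * ENNReal.ofReal (C / ‖1 - z‖) := by
        rw [lintegral_const_mul _ (by fun_prop)]
        gcongr
        exact lintegral_kernel_le hC hM hρ
    _ = _ := by rw [← ENNReal.ofReal_mul (by norm_num), mul_div_assoc]

theorem memQ_of_momentBound {μ : Measure (Set.Ico (0 : ℝ) 1)} [IsFiniteMeasure μ] {C : ℝ}
    (hC : 0 < C) (hM : MomentBound μ C) {p : ℝ} (hp : 0 < p) :
    MemQ p (cauchyTransform (toDisc μ)) := by
  refine ⟨differentiableOn_cauchyTransform μ, ?_⟩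
  set P := cauchyTransform (toDisc μ)
  set B : ℝ≥0∞ := (ENNReal.ofReal Real.pi)⁻¹ * (ENNReal.ofReal ((9 * C) ^ 2 * 16 ^ p) *
    (ENNReal.ofReal (2 / p) * ENNReal.ofReal (2 * Real.pi))) with hB
  have hBlt : B < ∞ := by
    have : (ENNReal.ofReal Real.pi)⁻¹ ≠ ∞ := by simpa using Real.pi_pos
    exact ENNReal.mul_lt_top this.lt_top (ENNReal.mul_lt_top ENNReal.ofReal_lt_top
      (ENNReal.mul_lt_top ENNReal.ofReal_lt_top ENNReal.ofReal_lt_top))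
  refine lt_of_le_of_lt (iSup₂_le fun a ha => ?_) hBlt
  have hd : 0 < ‖1 - a‖ := by
    rw [norm_pos_iff, sub_ne_zero]
    rintro rfl
    simp at ha
  rw [areaMeasure, lintegral_smul_measure, smul_eq_mul, hB]
  gcongr
  calc _ ≤ ∫⁻ z in Disc, ENNReal.ofReal ((9 * C) ^ 2 * 16 ^ p) * ENNReal.ofReal
          ((‖1 - z‖ ^ 2)⁻¹ * (min (‖1 - z‖ / ‖1 - a‖) (‖1 - a‖ / ‖1 - z‖)) ^ p) := by
        refine setLIntegral_mono' Metric.isOpen_ball.measurableSet fun z hz => ?_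
        rw [← ENNReal.ofReal_mul (by positivity)]
        refine ENNReal.ofReal_le_ofReal ?_
        obtain ⟨h0, h1⟩ := one_sub_mobius_sq_le ha hz
        have h2 := norm_deriv_le hC hM hz
        calc ‖deriv P z‖ ^ 2 * (1 - ‖mobius a z‖ ^ 2) ^ p
            ≤ (9 * C / ‖1 - z‖) ^ 2 *
                (16 * min (‖1 - z‖ / ‖1 - a‖) (‖1 - a‖ / ‖1 - z‖)) ^ p := by
              gcongr
          _ = _ := by
              rw [Real.mul_rpow (by norm_num) (by positivity), div_pow]
              ring
    _ ≤ ENNReal.ofReal ((9 * C) ^ 2 * 16 ^ p) * ∫⁻ z : ℂ, ENNReal.ofReal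
          ((‖1 - z‖ ^ 2)⁻¹ * (min (‖1 - z‖ / ‖1 - a‖) (‖1 - a‖ / ‖1 - z‖)) ^ p) := by
        rw [lintegral_const_mul _ (by fun_prop)]
        gcongr
        exact Measure.restrict_le_self
    _ ≤ _ := by
        gcongr
        exact lintegral_weight_le hp hd

/-! ### The equivalences -/

theorem theorem2 (μ : Measure (Set.Ico (0 : ℝ) 1)) :
    List.TFAE [
      -- (1) Hankel measure
      IsHankelMeasure (toDisc μ),
      -- (2) the integrals exist and are uniformly bounded over the disc
      (∀ w ∈ Disc, Integrable (fun t : Set.Ico (0 : ℝ) 1 =>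
          (1 - (‖w‖ : ℂ) ^ 2) / (1 - conj w * ((t : ℝ) : ℂ)) ^ 2) μ) ∧
        BddAbove ((fun w : ℂ => ‖∫ t : Set.Ico (0 : ℝ) 1,
          (1 - (‖w‖ : ℂ) ^ 2) / (1 - conj w * ((t : ℝ) : ℂ)) ^ 2 ∂μ‖) '' Disc),
      -- (3) for some p
      CauchyTransformExists (toDisc μ) ∧
        ∃ p : ℝ, 0 < p ∧ MemQ p (cauchyTransform (toDisc μ)),
      -- (4) for all p
      CauchyTransformExists (toDisc μ) ∧
        ∀ p : ℝ, 0 < p → MemQ p (cauchyTransform (toDisc μ)),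
      -- (5) the moments are finite and O(1/n)
      (∀ n : ℕ, Integrable (fun t : Set.Ico (0 : ℝ) 1 => (t : ℝ) ^ n) μ) ∧
        moment μ =O[atTop] (fun n : ℕ => 1 / (n : ℝ))] := by
  tfae_have 1 → 2 := kernel_bounded_of_isHankelMeasure
  tfae_have 2 → 5 := fun h => moments_of_kernel_bounded h.1 h.2
  tfae_have 5 → 1 := fun h => by
    obtain ⟨C, hC, hM⟩ := exists_momentBound h.1 h.2
    exact isHankelMeasure_of_momentBound hC hM
  tfae_have 5 → 4 := fun h => by
    obtain ⟨C, hC, hM⟩ := exists_momentBound h.1 h.2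
    have : IsFiniteMeasure μ := by simpa [integrable_const_iff] using h.1 0
    exact ⟨(cauchyTransformExists_iff μ).2 this, fun p hp => memQ_of_momentBound hC hM hp⟩
  tfae_have 4 → 3 := fun h => ⟨h.1, 1, one_pos, h.2 1 one_pos⟩
  tfae_have 3 → 5 := fun ⟨h, p, hp, hQ⟩ => by
    have := (cauchyTransformExists_iff μ).1 h
    exact ⟨integrable_pow μ, moments_of_memQ hp hQ⟩
  tfae_finish
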